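/- Let $R$ be a commutative ring and let $\mathcal{C}$ be an essentially small $R$-linear Frobenius category, that is, an additive $R$-linear exact category (in the sense of Quillen) with enough projectives and enough injectives in which the projective objects coincide with the injective ones. Assume that $\mathcal{C}$ is Krull--Schmidt (every object is a finite direct sum of indecomposable objects with local endomorphism rings) and that its stable category $\underline{\mathcal{C}}$, the quotient of $\mathcal{C}$ by the morphisms factoring through projective objects, is Hom-finite: $\operatorname{Hom}_{\underline{\mathcal{C}}}(X,Y)$ has finite $R$-length for all $X,Y$. Let $K_0(\mathcal{C},0)$ be the free abelian group on isomorphism classes $[A]$ of objects of $\mathcal{C}$ modulo the subgroup generated by all $[A\oplus B]-[A]-[B]$. Let $\operatorname{Ex}(\mathcal{C})\subseteq K_0(\mathcal{C},0)$ be the subgroup generated by all $[X]-[Y]+[Z]$ for which there is a short exact sequence $0\to X\to Y\to Z\to 0$ in $\mathcal{C}$, and let $\operatorname{AR}(\mathcal{C})$ be the subgroup generated by all $[X]-[Y]+[Z]$ for which there is an Auslander--Reiten sequence $0\to X\to Y\to Z\to 0$ in $\mathcal{C}$. Here a short exact sequence $0\to A\to B\xrightarrow{g} C\to 0$ is an Auslander--Reiten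 sequence if $A$ and $C$ are indecomposable, the sequence does not split, and every morphism $t\colon W\to C$ that is not a split epimorphism factors as $t=g\circ t'$ for some $t'\colon W\to B$. Assume that $\operatorname{Ex}(\mathcal{C})=\operatorname{AR}(\mathcal{C})$ in $K_0(\mathcal{C},0)$, and that there is an object $X$ of $\mathcal{C}$ such that $\operatorname{Hom}_{\underline{\mathcal{C}}}(Y,X)\neq 0$ for every non-zero object $Y$ of $\underline{\mathcal{C}}$. Then: 1. $\mathcal{C}$ has only finitely many isomorphism classes of non-projective indecomposable objects. 2. If $\mathcal{C}$ has only finitely many indecomposable projective objects up to isomorphism, then $\mathcal{C}$ has only finitely many isomorphism classes of indecomposable objects. -/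

import Mathlib

open CategoryTheory CategoryTheory.Limits

universe w v u

section

variable {C : Type u} [Category.{v} C] [Preadditive C] (conf : ShortComplex C → Prop)

/-- `i` is the first morphism of a short complex belonging to the class `conf`. -/
def IsInflationFor {X Y : C} (i : X ⟶ Y) : Prop :=
  ∃ (Z : C) (p : Y ⟶ Z) (h : i ≫ p = 0), conf (ShortComplex.mk i p h)

/-- `p` is the second morphism of a short complex belonging to the class `conf`. -/
def IsDeflationFor {Y Z : C} (p : Y ⟶ Z) : Prop :=
  ∃ (X : C) (i : X ⟶ Y) (h : i ≫ p = 0), conf (ShortComplex.mk i p h)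

end

/-- An exact structure (in the sense of Quillen) on an additive category `C`: a class of
kernel-cokernel pairs, called conflations or short exact sequences, closed under isomorphisms and
subject to the usual axioms. The first morphism of a conflation is called an inflation (admissible
monomorphism) and the second one a deflation (admissible epimorphism). -/
structure ExactStructure (C : Type u) [Category.{v} C] [Preadditive C] where
  /-- the short exact sequences `0 ⟶ X₁ ⟶ X₂ ⟶ X₃ ⟶ 0` of the exact category -/
  Conflation : ShortComplex C → Prop
  of_iso : ∀ {S T : ShortComplex C}, (S ≅ T) → Conflation S → Conflation T
  /-- in a conflation, the first morphism is a kernel of the second one -/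
  isKernel : ∀ S : ShortComplex C, Conflation S → Nonempty (IsLimit (KernelFork.ofι S.f S.zero))
  /-- in a conflation, the second morphism is a cokernel of the first one -/
  isCokernel : ∀ S : ShortComplex C, Conflation S →
    Nonempty (IsColimit (CokernelCofork.ofπ S.g S.zero))
  id_inflation : ∀ X : C, IsInflationFor Conflation (𝟙 X)
  id_deflation : ∀ X : C, IsDeflationFor Conflation (𝟙 X)
  comp_inflation : ∀ {X Y Z : C} (i : X ⟶ Y) (j : Y ⟶ Z), IsInflationFor Conflation i →
    IsInflationFor Conflation j → IsInflationFor Conflation (i ≫ j)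
  comp_deflation : ∀ {X Y Z : C} (p : X ⟶ Y) (q : Y ⟶ Z), IsDeflationFor Conflation p →
    IsDeflationFor Conflation q → IsDeflationFor Conflation (p ≫ q)
  /-- the pushout of an inflation along any morphism exists and is an inflation -/
  pushout_inflation : ∀ {X Y X' : C} (i : X ⟶ Y) (a : X ⟶ X'), IsInflationFor Conflation i →
    ∃ (Y' : C) (b : Y ⟶ Y') (i' : X' ⟶ Y'), IsPushout i a b i' ∧ IsInflationFor Conflation i'
  /-- the pullback of a deflation along any morphism exists and is a deflation -/
  pullback_deflation : ∀ {Y Z Z' : C} (p : Y ⟶ Z) (a : Z' ⟶ Z), IsDeflationFor Conflation p →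
    ∃ (Y' : C) (b : Y' ⟶ Y) (p' : Y' ⟶ Z'), IsPullback b p' p a ∧ IsDeflationFor Conflation p'

namespace ExactStructure

section

variable {C : Type u} [Category.{v} C] [Preadditive C] (E : ExactStructure C)

/-- `P` is projective in the exact category: morphisms from `P` lift along deflations. -/
def IsProjective (P : C) : Prop :=
  ∀ S : ShortComplex C, E.Conflation S → ∀ t : P ⟶ S.X₃, ∃ t' : P ⟶ S.X₂, t' ≫ S.g = t

/-- `I` is injective in the exact category: morphisms to `I` extend along inflations. -/
def IsInjective (I : C) : Prop :=
  ∀ S : ShortComplex C, E.Conflation S → ∀ t : S.X₁ ⟶ I, ∃ t' : S.X₂ ⟶ I, S.f ≫ t' = t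

/-- The exact category is a Frobenius category: it has enough projectives and enough injectives,
and the projective objects coincide with the injective objects. -/
structure IsFrobenius : Prop where
  enough_projectives : ∀ X : C, ∃ (K P : C) (i : K ⟶ P) (p : P ⟶ X) (h : i ≫ p = 0),
    E.Conflation (ShortComplex.mk i p h) ∧ E.IsProjective P
  enough_injectives : ∀ X : C, ∃ (I Q : C) (i : X ⟶ I) (p : I ⟶ Q) (h : i ≫ p = 0),
    E.Conflation (ShortComplex.mk i p h) ∧ E.IsInjective I
  projective_iff_injective : ∀ X : C, E.IsProjective X ↔ E.IsInjective X

/-- The morphism `f` factors through a projective object. -/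
def FactorsThroughProjective {X Y : C} (f : X ⟶ Y) : Prop :=
  ∃ (P : C) (a : X ⟶ P) (b : P ⟶ Y), E.IsProjective P ∧ a ≫ b = f

/-- Two parallel morphisms are identified in the stable category if their difference factors
through a projective object. -/
def stableRel : HomRel C := fun _ _ f g => E.FactorsThroughProjective (f - g)

variable {E}

lemma FactorsThroughProjective.precomp {X Y Z : C} (f : X ⟶ Y) {g : Y ⟶ Z}
    (h : E.FactorsThroughProjective g) : E.FactorsThroughProjective (f ≫ g) := by
  obtain ⟨P, a, b, hP, rfl⟩ := h
  exact ⟨P, f ≫ a, b, hP, by simp⟩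

lemma FactorsThroughProjective.postcomp {X Y Z : C} {f : X ⟶ Y} (g : Y ⟶ Z)
    (h : E.FactorsThroughProjective f) : E.FactorsThroughProjective (f ≫ g) := by
  obtain ⟨P, a, b, hP, rfl⟩ := h
  exact ⟨P, a, b ≫ g, hP, by simp⟩

lemma FactorsThroughProjective.neg {X Y : C} {f : X ⟶ Y}
    (h : E.FactorsThroughProjective f) : E.FactorsThroughProjective (-f) := by
  obtain ⟨P, a, b, hP, rfl⟩ := h
  exact ⟨P, -a, b, hP, by simp⟩

lemma FactorsThroughProjective.smul {R : Type*} [CommRing R] [Linear R C] (r : R) {X Y : C}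
    {f : X ⟶ Y} (h : E.FactorsThroughProjective f) : E.FactorsThroughProjective (r • f) := by
  obtain ⟨P, a, b, hP, rfl⟩ := h
  exact ⟨P, r • a, b, hP, by simp⟩

lemma stableRel_smul {R : Type*} [CommRing R] [Linear R C] (r : R) ⦃X Y : C⦄ (f₁ f₂ : X ⟶ Y)
    (h : E.stableRel f₁ f₂) : E.stableRel (r • f₁) (r • f₂) := by
  have := FactorsThroughProjective.smul r h
  rwa [smul_sub] at this

variable [HasFiniteBiproducts C]

variable (E) in
lemma factorsThroughProjective_zero (X Y : C) :
    E.FactorsThroughProjective (0 : X ⟶ Y) := by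
  have : HasZeroObject C := inferInstance
  obtain ⟨Z, hZ⟩ := this
  exact ⟨Z, 0, 0, fun S _ t => ⟨0, hZ.eq_of_src _ _⟩, by simp⟩

lemma FactorsThroughProjective.add {X Y : C} {f g : X ⟶ Y} (hf : E.FactorsThroughProjective f)
    (hg : E.FactorsThroughProjective g) : E.FactorsThroughProjective (f + g) := by
  have : HasBinaryBiproducts C := hasBinaryBiproducts_of_finite_biproducts C
  obtain ⟨P, a, b, hP, rfl⟩ := hf
  obtain ⟨Q, c, d, hQ, rfl⟩ := hg
  refine ⟨P ⊞ Q, biprod.lift a c, biprod.desc b d, fun S hS t => ?_, by simp⟩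
  obtain ⟨s₁, h₁⟩ := hP S hS (biprod.inl ≫ t)
  obtain ⟨s₂, h₂⟩ := hQ S hS (biprod.inr ≫ t)
  exact ⟨biprod.desc s₁ s₂, by ext <;> simp [h₁, h₂]⟩

instance congruence_stableRel : Congruence E.stableRel where
  comp_left f _ _ h := by
    have := FactorsThroughProjective.precomp f h
    rwa [Preadditive.comp_sub] at this
  comp_right g h := by
    have := FactorsThroughProjective.postcomp g h
    rwa [Preadditive.sub_comp] at this
  equivalence :=
    { refl := fun f => by
        simpa [stableRel] using E.factorsThroughProjective_zero _ _
      symm := fun h => by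
        have := FactorsThroughProjective.neg h
        rwa [neg_sub] at this
      trans := fun h₁ h₂ => by
        have := FactorsThroughProjective.add h₁ h₂
        rwa [sub_add_sub_cancel] at this }

lemma stableRel_add ⦃X Y : C⦄ (f₁ f₂ g₁ g₂ : X ⟶ Y) (hf : E.stableRel f₁ f₂)
    (hg : E.stableRel g₁ g₂) : E.stableRel (f₁ + g₁) (f₂ + g₂) := by
  have := FactorsThroughProjective.add hf hg
  rwa [sub_add_sub_comm] at this

variable (E)

/-- The stable category: the quotient of `C` by the morphisms factoring through a projective
object. -/
abbrev StableCategory : Type u := CategoryTheory.Quotient E.stableRel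

/-- The projection functor from `C` to its stable category. -/
abbrev toStable : C ⥤ E.StableCategory := CategoryTheory.Quotient.functor E.stableRel

instance preadditiveStableCategory : Preadditive E.StableCategory :=
  CategoryTheory.Quotient.preadditive E.stableRel stableRel_add

instance additive_toStable : E.toStable.Additive :=
  CategoryTheory.Quotient.functor_additive E.stableRel stableRel_add

instance linearStableCategory (R : Type*) [CommRing R] [Linear R C] :
    Linear R E.StableCategory :=
  CategoryTheory.Quotient.linear R E.stableRel stableRel_smul

end

end ExactStructure

/-- An `R`-linear category is Hom-finite if all its morphism modules have finite `R`-length. -/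
def IsHomFinite (R : Type*) [CommRing R] (D : Type u) [Category.{v} D] [Preadditive D]
    [Linear R D] : Prop :=
  ∀ X Y : D, IsFiniteLength R (X ⟶ Y)

section

variable (C : Type u) [Category.{v} C] [Preadditive C] [HasBinaryBiproducts C]

/-- Every object is a finite direct sum of indecomposable objects with local endomorphism ring. -/
def IsKrullSchmidt [HasFiniteBiproducts C] : Prop :=
  ∀ X : C, ∃ (n : ℕ) (Y : Fin n → C),
    (∀ i, Indecomposable (Y i) ∧ IsLocalRing (End (Y i))) ∧ Nonempty (X ≅ ⨁ Y)

/-- Isomorphism classes of objects. -/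
abbrev IsoClass : Type u := _root_.Quotient (isIsomorphicSetoid C)

/-- The isomorphism class of an object. -/
def isoClass {C : Type u} [Category.{v} C] (X : C) : IsoClass C :=
  _root_.Quotient.mk (isIsomorphicSetoid C) X

/-- The subgroup of the free abelian group on isomorphism classes generated by the elements
`[A ⊕ B] - [A] - [B]`. -/
def splitRelations : AddSubgroup (FreeAbelianGroup (IsoClass C)) :=
  AddSubgroup.closure {x | ∃ A B : C, x = FreeAbelianGroup.of (isoClass (A ⊞ B)) -
    FreeAbelianGroup.of (isoClass A) - FreeAbelianGroup.of (isoClass B)}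

/-- The split Grothendieck group `K₀(C, 0)`. -/
abbrev SplitK0 : Type u := FreeAbelianGroup (IsoClass C) ⧸ splitRelations C

/-- The class of an object in `K₀(C, 0)`. -/
def splitK0Class {C : Type u} [Category.{v} C] [Preadditive C] [HasBinaryBiproducts C] (X : C) :
    SplitK0 C :=
  QuotientAddGroup.mk (FreeAbelianGroup.of (isoClass X))

/-- The objects satisfying `P` fall into finitely many isomorphism classes. -/
def FinitelyManyUpToIso {C : Type u} [Category.{v} C] (P : C → Prop) : Prop :=
  {c : IsoClass C | ∃ X : C, P X ∧ isoClass X = c}.Finite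

end

namespace ExactStructure

variable {C : Type u} [Category.{v} C] [Preadditive C] [HasBinaryBiproducts C]
  (E : ExactStructure C)

/-- Auslander-Reiten sequences `0 ⟶ A ⟶ B ⟶ C ⟶ 0` in an exact category. -/
structure IsARSequence (S : ShortComplex C) : Prop where
  conflation : E.Conflation S
  indecomposable_left : Indecomposable S.X₁
  indecomposable_right : Indecomposable S.X₃
  not_split : ¬ Nonempty S.Splitting
  lift : ∀ (W : C) (t : W ⟶ S.X₃), ¬ IsSplitEpi t → ∃ t' : W ⟶ S.X₂, t' ≫ S.g = t

/-- The subgroup `Ex(C)` of `K₀(C, 0)` generated by `[X] - [Y] + [Z]` for all short exact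
sequences `0 ⟶ X ⟶ Y ⟶ Z ⟶ 0`. -/
def exSubgroup : AddSubgroup (SplitK0 C) :=
  AddSubgroup.closure {x | ∃ S : ShortComplex C, E.Conflation S ∧
    x = splitK0Class S.X₁ - splitK0Class S.X₂ + splitK0Class S.X₃}

/-- The subgroup `AR(C)` of `K₀(C, 0)` generated by `[X] - [Y] + [Z]` for all Auslander-Reiten
sequences `0 ⟶ X ⟶ Y ⟶ Z ⟶ 0`. -/
def arSubgroup : AddSubgroup (SplitK0 C) :=
  AddSubgroup.closure {x | ∃ S : ShortComplex C, E.IsARSequence S ∧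
    x = splitK0Class S.X₁ - splitK0Class S.X₂ + splitK0Class S.X₃}

end ExactStructure

/-!
Let `W` be a non-projective indecomposable object. Sending `Z` to the length of the stable morphism
module from `W` to `Z` defines an additive function on `K₀(C, 0)` (`stableLengthHom`). On an
Auslander-Reiten sequence `0 ⟶ X₁ ⟶ X₂ ⟶ X₃ ⟶ 0` this function vanishes for all but finitely many
`W`. Indeed the induced sequence of stable morphism modules is always exact in the middle, it is
exact on the right unless `W ≅ X₃`, and it is exact on the left unless `X₃` is a direct summand of
a cosyzygy `V` of `W`, the cokernel of an inflation of `W` into an injective object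
(`factorsThroughProjective_of_comp_f`). In the last case `W` is a direct summand of any syzygy of
`X₃` (`retract_syzygy_of_retract_cosyzygy`), and by the Krull-Schmidt property an object has only
finitely many indecomposable direct summands.

Consequently every element of `AR(C)` is annihilated by the functions of all but finitely many `W`.
For a conflation `0 ⟶ K ⟶ P ⟶ X ⟶ 0` with `P` projective, where `X` receives a non-zero stable
morphism from every non-zero object, the element `[K] - [P] + [X]` lies in `Ex(C) = AR(C)`, but the
function of `W` takes on it a value at least as large as the length of the non-zero module of stable
morphisms from `W` to `X`. So there are only finitely many `W` altogether.
-/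

/-! ### Indecomposable objects in Krull-Schmidt categories -/

section KrullSchmidt

variable {C : Type u} [Category.{v} C]

lemma isoClass_eq_iff {X Y : C} : isoClass X = isoClass Y ↔ Nonempty (X ≅ Y) :=
  Quotient.eq (r := isIsomorphicSetoid C)

variable [Preadditive C]

/-- In a possibly noncommutative local ring, a finite sum of non-units is not a unit. -/
lemma IsLocalRing.exists_isUnit_of_isUnit_sum {A ι : Type*} [Ring A] [IsLocalRing A]
    (s : Finset ι) (f : ι → A) (h : IsUnit (∑ i ∈ s, f i)) : ∃ i ∈ s, IsUnit (f i) := by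
  classical
  induction s using Finset.induction_on with
  | empty => simp at h
  | insert a s ha ih =>
    rw [Finset.sum_insert ha] at h
    obtain ⟨u, hu⟩ := h
    have h1 : (↑u⁻¹ : A) * f a + (↑u⁻¹ : A) * ∑ i ∈ s, f i = 1 := by
      rw [← mul_add, ← hu, Units.inv_mul]
    rcases IsLocalRing.isUnit_or_isUnit_of_add_one h1 with h2 | h2
    · exact ⟨a, Finset.mem_insert_self _ _, by simpa using h2⟩
    · obtain ⟨i, hi, hu'⟩ := ih (by simpa using h2)
      exact ⟨i, Finset.mem_insert_of_mem hi, hu'⟩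

lemma isIso_or_isIso_id_sub {X : C} [IsLocalRing (End X)] (f : X ⟶ X) :
    IsIso f ∨ IsIso (𝟙 X - f) := by
  have hadd : (f : End X) + (𝟙 X - f : X ⟶ X) = (1 : End X) := add_sub_cancel f (𝟙 X)
  exact (IsLocalRing.isUnit_or_isUnit_of_add_one hadd).imp (isUnit_iff_isIso _).1
    (isUnit_iff_isIso _).1

/-- An idempotent of a local ring is `0` or `1`, so a non-zero retract of an object with local
endomorphism ring is isomorphic to it. -/
lemma nonempty_iso_of_retract {W Y : C} [IsLocalRing (End Y)] (hW : ¬ IsZero W)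
    (s : W ⟶ Y) (r : Y ⟶ W) (h : s ≫ r = 𝟙 W) : Nonempty (W ≅ Y) := by
  have hs : s ≫ (𝟙 Y - r ≫ s) = 0 := by simp [reassoc_of% h]
  rcases isIso_or_isIso_id_sub (r ≫ s) with hu | hu
  · have h2 : (𝟙 Y - r ≫ s) = 0 := by
      rw [← cancel_epi (r ≫ s), Category.assoc, hs]; simp
    exact ⟨⟨s, r, h, (sub_eq_zero.1 h2).symm⟩⟩
  · have h2 : s = 0 := by rw [← cancel_mono (𝟙 Y - r ≫ s), hs, zero_comp]
    exact absurd ((IsZero.iff_id_eq_zero W).2 (by rw [← h, h2, zero_comp])) hW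

lemma isLocalRing_end_of_iso {X Y : C} (e : X ≅ Y) [IsLocalRing (End X)] :
    IsLocalRing (End Y) := by
  have : Nontrivial (End Y) := e.conj.symm.toEquiv.nontrivial
  refine ⟨fun {a b} hab => ?_⟩
  have key : ∀ c : End Y, IsUnit (e.symm.conj c) → IsUnit c := fun c hc => by
    simpa using hc.map e.conj
  have h1 : e.symm.conj a + e.symm.conj b = 1 := by
    have : e.symm.conj (a + b) = 1 := by rw [hab, map_one]
    rw [← this]
    have hlin : ∀ f g : Y ⟶ Y, e.hom ≫ f ≫ e.inv + e.hom ≫ g ≫ e.inv =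
        e.hom ≫ (f + g) ≫ e.inv := fun f g => by
      rw [Preadditive.add_comp, Preadditive.comp_add]
    exact hlin a b
  exact (IsLocalRing.isUnit_or_isUnit_of_add_one h1).imp (key a) (key b)

variable [HasFiniteBiproducts C]

/-- A finite biproduct splits off its first summand. -/
lemma nonempty_iso_biprod_of_succ [HasBinaryBiproducts C] {n : ℕ} (Y : Fin (n + 1) → C) :
    Nonempty (⨁ Y ≅ Y 0 ⊞ ⨁ fun j : Fin n => Y j.succ) := by
  let b : BinaryBicone (Y 0) (⨁ fun j : Fin n => Y j.succ) :=
    { pt := ⨁ Y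
      fst := biproduct.π Y 0
      snd := biproduct.lift fun j => biproduct.π Y j.succ
      inl := biproduct.ι Y 0
      inr := biproduct.desc fun j => biproduct.ι Y j.succ
      inl_fst := by simp
      inl_snd := by
        ext j
        simp [biproduct.ι_π_ne Y (Fin.succ_ne_zero j).symm]
      inr_fst := by
        ext j
        simp [biproduct.ι_π_ne Y (Fin.succ_ne_zero j)]
      inr_snd := by
        ext j k
        by_cases h : k = j
        · subst h; simp
        · have h' : k.succ ≠ j.succ := fun h' => h (Fin.succ_injective _ h')
          simp [biproduct.ι_π_ne _ h, biproduct.ι_π_ne _ h'] }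
  have hb : b.IsBilimit := isBinaryBilimitOfTotal b (by
    rw [show 𝟙 b.pt = 𝟙 (⨁ Y) from rfl, ← biproduct.total, Fin.sum_univ_succ]
    simp [b, biproduct.lift_desc])
  exact ⟨biprod.uniqueUpToIso _ _ hb⟩

lemma isLocalRing_end_of_indecomposable [HasBinaryBiproducts C] (hKS : IsKrullSchmidt C) {W : C}
    (hW : Indecomposable W) : IsLocalRing (End W) := by
  obtain ⟨n, Y, hY, ⟨e⟩⟩ := hKS W
  cases n with
  | zero =>
    refine absurd (IsZero.of_iso ?_ e) hW.1
    rw [IsZero.iff_id_eq_zero]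
    ext j
    exact j.elim0
  | succ n =>
    obtain ⟨e'⟩ := nonempty_iso_biprod_of_succ Y
    rcases hW.2 _ _ (e ≪≫ e') with h | h
    · exact absurd h (hY 0).1.1
    · have : IsLocalRing (End (Y 0)) := (hY 0).2
      exact isLocalRing_end_of_iso ((e ≪≫ e').trans (isoBiprodZero h).symm).symm

/-- In a Krull-Schmidt category an object has only finitely many indecomposable direct summands. -/
lemma finitelyManyUpToIso_retract [HasBinaryBiproducts C] (hKS : IsKrullSchmidt C) (Z : C) :
    FinitelyManyUpToIso fun W : C =>
      Indecomposable W ∧ ∃ (s : W ⟶ Z) (r : Z ⟶ W), s ≫ r = 𝟙 W := by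
  obtain ⟨n, Y, hY, ⟨e⟩⟩ := hKS Z
  refine (Set.finite_range fun j => isoClass (Y j)).subset ?_
  rintro _ ⟨W, ⟨hW, s, r, h⟩, rfl⟩
  have := isLocalRing_end_of_indecomposable hKS hW
  -- the identity of `W` is the sum of the endomorphisms factoring through the summands `Y j`
  have hsum : ∑ j, (s ≫ e.hom ≫ biproduct.π Y j ≫ biproduct.ι Y j ≫ e.inv ≫ r : W ⟶ W) = (1 : End W) := by
    have h0 : s ≫ e.hom ≫ (∑ j, biproduct.π Y j ≫ biproduct.ι Y j) ≫ e.inv ≫ r = 𝟙 W := by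
      rw [biproduct.total]; simp [h]
    simp only [Preadditive.sum_comp, Preadditive.comp_sum, Category.assoc] at h0
    exact h0
  obtain ⟨j, -, hj⟩ := IsLocalRing.exists_isUnit_of_isUnit_sum (A := End W) _ _ (hsum ▸ isUnit_one)
  have hiso : IsIso (s ≫ e.hom ≫ biproduct.π Y j ≫ biproduct.ι Y j ≫ e.inv ≫ r) :=
    (isUnit_iff_isIso _).1 hj
  have := (hY j).2
  obtain ⟨e'⟩ := nonempty_iso_of_retract hW.1 (s ≫ e.hom ≫ biproduct.π Y j)
    ((biproduct.ι Y j ≫ e.inv ≫ r) ≫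
      inv (s ≫ e.hom ≫ biproduct.π Y j ≫ biproduct.ι Y j ≫ e.inv ≫ r))
    (by simpa only [Category.assoc] using
      IsIso.hom_inv_id (s ≫ e.hom ≫ biproduct.π Y j ≫ biproduct.ι Y j ≫ e.inv ≫ r))
  exact ⟨j, isoClass_eq_iff.2 ⟨e'.symm⟩⟩

end KrullSchmidt

namespace ExactStructure

/-! ### Conflations and projective objects -/

section Conflation

variable {C : Type u} [Category.{v} C] [Preadditive C] {E : ExactStructure C}

lemma Conflation.exists_lift {S : ShortComplex C} (hS : E.Conflation S) {W : C} (k : W ⟶ S.X₂)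
    (hk : k ≫ S.g = 0) : ∃ l : W ⟶ S.X₁, l ≫ S.f = k := by
  obtain ⟨h⟩ := E.isKernel S hS
  obtain ⟨l, hl⟩ := KernelFork.IsLimit.lift' h k hk
  exact ⟨l, hl⟩

lemma Conflation.exists_desc {S : ShortComplex C} (hS : E.Conflation S) {W : C} (k : S.X₂ ⟶ W)
    (hk : S.f ≫ k = 0) : ∃ l : S.X₃ ⟶ W, S.g ≫ l = k := by
  obtain ⟨h⟩ := E.isCokernel S hS
  obtain ⟨l, hl⟩ := CokernelCofork.IsColimit.desc' h k hk
  exact ⟨l, hl⟩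

lemma Conflation.mono_f {S : ShortComplex C} (hS : E.Conflation S) : Mono S.f := by
  obtain ⟨h⟩ := E.isKernel S hS
  exact mono_of_isLimit_fork h

lemma Conflation.epi_g {S : ShortComplex C} (hS : E.Conflation S) : Epi S.g := by
  obtain ⟨h⟩ := E.isCokernel S hS
  exact epi_of_isColimit_cofork h

lemma Conflation.nonempty_splitting {S : ShortComplex C} (hS : E.Conflation S)
    (s : S.X₃ ⟶ S.X₂) (hs : s ≫ S.g = 𝟙 S.X₃) : Nonempty S.Splitting := by
  have := Conflation.mono_f hS
  obtain ⟨r, hr⟩ := Conflation.exists_lift hS (𝟙 S.X₂ - S.g ≫ s) (by simp [hs])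
  refine ⟨⟨r, s, ?_, hs, by rw [hr]; abel⟩⟩
  rw [← cancel_mono S.f, Category.assoc, hr]
  simp

lemma IsProjective.of_retract {P Q : C} (hP : E.IsProjective P) (s : Q ⟶ P) (r : P ⟶ Q)
    (h : s ≫ r = 𝟙 Q) : E.IsProjective Q := by
  intro S hS t
  obtain ⟨t', ht'⟩ := hP S hS (r ≫ t)
  exact ⟨s ≫ t', by rw [Category.assoc, ht', reassoc_of% h]⟩

lemma isProjective_of_factorsThroughProjective_id {X : C}
    (h : E.FactorsThroughProjective (𝟙 X)) : E.IsProjective X := by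
  obtain ⟨P, a, b, hP, hab⟩ := h
  exact hP.of_retract a b hab

lemma IsARSequence.not_isProjective [HasBinaryBiproducts C] {S : ShortComplex C}
    (hS : E.IsARSequence S) : ¬ E.IsProjective S.X₃ := fun h => by
  obtain ⟨s, hs⟩ := h S hS.conflation (𝟙 _)
  exact hS.not_split (Conflation.nonempty_splitting hS.conflation s hs)

/-- If the syzygy of an object with respect to some projective presentation is projective, then so
is the object itself. -/
lemma IsFrobenius.isProjective_of_syzygy (hE : E.IsFrobenius) {S : ShortComplex C}
    (hS : E.Conflation S) (h₁ : E.IsProjective S.X₁) (h₂ : E.IsProjective S.X₂) :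
    E.IsProjective S.X₃ := by
  have := Conflation.epi_g hS
  obtain ⟨t, ht⟩ := (hE.projective_iff_injective _).1 h₁ S hS (𝟙 _)
  obtain ⟨m, hm⟩ := Conflation.exists_desc hS (𝟙 S.X₂ - t ≫ S.f) (by simp [reassoc_of% ht])
  refine h₂.of_retract m S.g ?_
  rw [← cancel_epi S.g, reassoc_of% hm]
  simp

/-- Injectivity on the left of the sequence of stable morphism groups from `T.X₁` to an
Auslander-Reiten sequence, provided that the right end of the latter is not a direct summand of the
cosyzygy `T.X₃`. -/
lemma factorsThroughProjective_of_comp_f [HasBinaryBiproducts C] (hE : E.IsFrobenius)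
    {S T : ShortComplex C}
    (hS : E.IsARSequence S) (hT : E.Conflation T) (hT₂ : E.IsProjective T.X₂)
    (hST : ∀ (s : S.X₃ ⟶ T.X₃) (r : T.X₃ ⟶ S.X₃), s ≫ r ≠ 𝟙 _) (f : T.X₁ ⟶ S.X₁)
    (hf : E.FactorsThroughProjective (f ≫ S.f)) : E.FactorsThroughProjective f := by
  have := Conflation.mono_f hS.conflation
  obtain ⟨Q, a, b, hQ, hab⟩ := hf
  obtain ⟨a', ha'⟩ := (hE.projective_iff_injective Q).1 hQ T hT a
  -- `f` extends to a morphism of short exact sequences, whose right component lifts along `S.g`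
  obtain ⟨h, hh⟩ := Conflation.exists_desc hT (a' ≫ b ≫ S.g) (by
    rw [reassoc_of% ha', reassoc_of% hab]; simp)
  obtain ⟨t, ht⟩ := hS.lift _ h (fun ⟨⟨sp⟩⟩ => hST sp.section_ h sp.id)
  obtain ⟨l, hl⟩ := Conflation.exists_lift hS.conflation (a' ≫ b - T.g ≫ t) (by simp [ht, hh])
  refine ⟨T.X₂, T.f, l, hT₂, ?_⟩
  rw [← cancel_mono S.f, Category.assoc, hl]
  simp [reassoc_of% ha', hab]

end Conflation

/-! ### Stable morphisms -/

section Stable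

variable {C : Type u} [Category.{v} C] [Preadditive C] [HasFiniteBiproducts C]
  {E : ExactStructure C}

lemma toStable_map_eq_zero_iff {X Y : C} (f : X ⟶ Y) :
    E.toStable.map f = 0 ↔ E.FactorsThroughProjective f := by
  rw [← E.toStable.map_zero X Y, CategoryTheory.Quotient.functor_map_eq_iff]
  simp [stableRel]

lemma isProjective_iff_isZero_toStable {X : C} :
    E.IsProjective X ↔ IsZero (E.toStable.obj X) := by
  rw [IsZero.iff_id_eq_zero, ← E.toStable.map_id, toStable_map_eq_zero_iff]
  exact ⟨fun h => ⟨X, 𝟙 X, 𝟙 X, h, by simp⟩, isProjective_of_factorsThroughProjective_id⟩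

/-- Up to projective summands, syzygies invert cosyzygies: if the non-projective object `S.X₃` is a
direct summand of the cosyzygy `T.X₃` of an object `T.X₁` with local endomorphism ring, then `T.X₁`
is a direct summand of the syzygy `S.X₁`. -/
lemma retract_syzygy_of_retract_cosyzygy (hE : E.IsFrobenius) {S T : ShortComplex C}
    (hS : E.Conflation S) (hT : E.Conflation T) (hS₂ : E.IsProjective S.X₂)
    (hT₂ : E.IsProjective T.X₂) (hS₃ : ¬ E.IsProjective S.X₃) [IsLocalRing (End T.X₁)]
    (s : S.X₃ ⟶ T.X₃) (r : T.X₃ ⟶ S.X₃) (h : s ≫ r = 𝟙 _) :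
    ∃ (a : T.X₁ ⟶ S.X₁) (b : S.X₁ ⟶ T.X₁), a ≫ b = 𝟙 _ := by
  have := Conflation.mono_f hS
  -- `s` and `r` lift to morphisms of short exact sequences
  obtain ⟨s₂, hs₂⟩ := hS₂ T hT (S.g ≫ s)
  obtain ⟨r₂, hr₂⟩ := hT₂ S hS (T.g ≫ r)
  obtain ⟨β, hβ⟩ := Conflation.exists_lift hT (S.f ≫ s₂) (by simp [hs₂])
  obtain ⟨α, hα⟩ := Conflation.exists_lift hS (T.f ≫ r₂) (by simp [hr₂])
  -- the lift of `s ≫ r = 𝟙` is stably the identity, by the usual chain homotopy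
  obtain ⟨c, hc⟩ := Conflation.exists_lift hS (s₂ ≫ r₂ - 𝟙 S.X₂) (by
    simp [hr₂, reassoc_of% hs₂, h])
  have hβα : β ≫ α - 𝟙 S.X₁ = S.f ≫ c := by
    rw [← cancel_mono S.f]
    simp [hc, hα, reassoc_of% hβ]
  have hst : E.toStable.map β ≫ E.toStable.map α = 𝟙 _ := by
    have h0 : E.toStable.map (β ≫ α - 𝟙 S.X₁) = 0 :=
      (toStable_map_eq_zero_iff _).2 ⟨S.X₂, S.f, c, hS₂, hβα.symm⟩
    rw [Functor.map_sub, sub_eq_zero] at h0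
    simpa using h0
  rcases isIso_or_isIso_id_sub (α ≫ β) with hu | hu
  · exact ⟨α, β ≫ inv (α ≫ β), by rw [← Category.assoc, IsIso.hom_inv_id]⟩
  -- otherwise the stable idempotent `α ≫ β` vanishes, so that the syzygy `S.X₁` is stably zero
  · exfalso
    have h1 : E.toStable.map (α ≫ β) = 0 := by
      rw [← cancel_mono (E.toStable.map (𝟙 T.X₁ - α ≫ β)), Functor.map_sub]
      simp [reassoc_of% hst]
    have h2 : 𝟙 (E.toStable.obj S.X₁) = 0 := by
      calc 𝟙 (E.toStable.obj S.X₁)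
          = E.toStable.map β ≫ E.toStable.map (α ≫ β) ≫ E.toStable.map α := by
            simp [hst]
        _ = 0 := by rw [h1]; simp
    exact hS₃ (hE.isProjective_of_syzygy hS
      (isProjective_iff_isZero_toStable.2 ((IsZero.iff_id_eq_zero _).2 h2)) hS₂)

/-- Exactness in the middle of the sequence of stable morphism groups. -/
lemma exact_toStable {S : ShortComplex C} (hS : E.Conflation S) {W : C} (f : W ⟶ S.X₂)
    (hf : E.FactorsThroughProjective (f ≫ S.g)) :
    ∃ l : W ⟶ S.X₁, E.toStable.map (l ≫ S.f) = E.toStable.map f := by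
  obtain ⟨Q, a, b, hQ, hab⟩ := hf
  obtain ⟨b', hb'⟩ := hQ S hS b
  obtain ⟨l, hl⟩ := Conflation.exists_lift hS (f - a ≫ b') (by simp [hb', hab])
  refine ⟨l, ?_⟩
  rw [hl, Functor.map_sub, (toStable_map_eq_zero_iff (a ≫ b')).2 ⟨Q, a, b', hQ, rfl⟩, sub_zero]

/-! ### The length of stable morphism modules as a function on the split Grothendieck group -/

variable (R : Type*) [CommRing R] [Linear R C]

variable (E) in
/-- The length of the module of stable morphisms from `W` to `Z`, as an integer. It is meaningful
only if this length is finite. -/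
noncomputable def stableLength (W Z : C) : ℤ :=
  ((Module.length R (E.toStable.obj W ⟶ E.toStable.obj Z)).toNat : ℤ)

variable {R}

lemma stableLength_eq_add (hfin : IsHomFinite R E.StableCategory) {W X Y Z : C} (f : X ⟶ Y)
    (g : Y ⟶ Z) (hinj : ∀ k : W ⟶ X, E.toStable.map (k ≫ f) = 0 → E.toStable.map k = 0)
    (hfg : E.toStable.map (f ≫ g) = 0)
    (hex : ∀ k : W ⟶ Y, E.toStable.map (k ≫ g) = 0 →
      ∃ l : W ⟶ X, E.toStable.map (l ≫ f) = E.toStable.map k)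
    (hsurj : ∀ k : W ⟶ Z, ∃ l : W ⟶ Y, E.toStable.map (l ≫ g) = E.toStable.map k) :
    stableLength E R W Y = stableLength E R W X + stableLength E R W Z := by
  have hlen := Module.length_eq_add_of_exact
    (Linear.rightComp R (E.toStable.obj W) (E.toStable.map f))
    (Linear.rightComp R (E.toStable.obj W) (E.toStable.map g))
    ((injective_iff_map_eq_zero _).2 fun k hk => by
      obtain ⟨k, rfl⟩ := E.toStable.map_surjective k
      exact hinj k (by simpa using hk))
    (fun k => by
      obtain ⟨k, rfl⟩ := E.toStable.map_surjective k
      obtain ⟨l, hl⟩ := hsurj k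
      exact ⟨E.toStable.map l, by simpa using hl⟩)
    (fun k => by
      obtain ⟨k, rfl⟩ := E.toStable.map_surjective k
      constructor
      · intro hk
        obtain ⟨l, hl⟩ := hex k (by simpa using hk)
        exact ⟨E.toStable.map l, by simpa using hl⟩
      · rintro ⟨l, hl⟩
        rw [← hl]
        rw [Functor.map_comp] at hfg
        simp [hfg])
  rw [stableLength, stableLength, stableLength, hlen,
    ENat.toNat_add (Module.length_ne_top_iff.2 (hfin _ _)) (Module.length_ne_top_iff.2 (hfin _ _)),
    Nat.cast_add]

variable (R) in
lemma stableLength_congr (W : C) {X Y : C} (e : X ≅ Y) :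
    stableLength E R W X = stableLength E R W Y := by
  rw [stableLength, stableLength,
    (Linear.homCongr R (Iso.refl (E.toStable.obj W)) (E.toStable.mapIso e)).length_eq]

variable (R) in
lemma stableLength_of_isProjective (W : C) {P : C} (hP : E.IsProjective P) :
    stableLength E R W P = 0 := by
  have hz := isProjective_iff_isZero_toStable.1 hP
  have : Subsingleton (E.toStable.obj W ⟶ E.toStable.obj P) := ⟨hz.eq_of_tgt⟩
  rw [stableLength, Module.length_eq_zero]
  rfl

lemma stableLength_pos (hfin : IsHomFinite R E.StableCategory) {W X : C}
    (f : E.toStable.obj W ⟶ E.toStable.obj X) (hf : f ≠ 0) : 0 < stableLength E R W X := by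
  have : Nontrivial (E.toStable.obj W ⟶ E.toStable.obj X) := ⟨f, 0, hf⟩
  have hpos : 0 < Module.length R (E.toStable.obj W ⟶ E.toStable.obj X) := Module.length_pos
  rw [stableLength, Nat.cast_pos, Nat.pos_iff_ne_zero, ne_eq, ENat.toNat_eq_zero, not_or]
  exact ⟨hpos.ne', Module.length_ne_top_iff.2 (hfin _ _)⟩

variable [HasBinaryBiproducts C]

lemma stableLength_biprod (hfin : IsHomFinite R E.StableCategory) (W X Y : C) :
    stableLength E R W (X ⊞ Y) = stableLength E R W X + stableLength E R W Y := by
  refine stableLength_eq_add hfin biprod.inl biprod.snd (fun k hk => ?_) (by simp)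
    (fun k hk => ⟨k ≫ biprod.fst, ?_⟩) (fun k => ⟨k ≫ biprod.inr, by simp⟩)
  · have := congrArg (· ≫ E.toStable.map biprod.fst) hk
    simpa [← Functor.map_comp] using this
  · have h1 : k = (k ≫ biprod.fst) ≫ biprod.inl + (k ≫ biprod.snd) ≫ biprod.inr := by
      simp [← Preadditive.comp_add, biprod.total]
    conv_rhs => rw [h1, Functor.map_add, Functor.map_comp _ (k ≫ biprod.snd), hk]
    simp

/-- The additive function on the split Grothendieck group sending `[Z]` to the length of the module
of stable morphisms from `W` to `Z`. -/
noncomputable def stableLengthHom (hfin : IsHomFinite R E.StableCategory) (W : C) :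
    SplitK0 C →+ ℤ :=
  QuotientAddGroup.lift (splitRelations C)
    (FreeAbelianGroup.lift (_root_.Quotient.lift (stableLength E R W)
      fun _ _ ⟨e⟩ => stableLength_congr R W e))
    (by
      rw [splitRelations, AddSubgroup.closure_le]
      rintro _ ⟨A, B, rfl⟩
      have := stableLength_biprod hfin W A B
      simp only [SetLike.mem_coe, AddMonoidHom.mem_ker, map_sub, FreeAbelianGroup.lift_apply_of]
      change stableLength E R W (A ⊞ B) - stableLength E R W A - stableLength E R W B = 0
      omega)

@[simp]
lemma stableLengthHom_splitK0Class (hfin : IsHomFinite R E.StableCategory) (W Z : C) :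
    stableLengthHom hfin W (splitK0Class Z) = stableLength E R W Z := by
  simp only [stableLengthHom, splitK0Class, QuotientAddGroup.lift_mk,
    FreeAbelianGroup.lift_apply_of]
  rfl

/-! ### Finiteness -/

/-- The stable length function of `W` vanishes on a given Auslander-Reiten sequence for all but
finitely many indecomposable `W`. -/
lemma IsARSequence.finitelyManyUpToIso_stableLengthHom_ne_zero (hE : E.IsFrobenius)
    (hKS : IsKrullSchmidt C) (hfin : IsHomFinite R E.StableCategory) {S : ShortComplex C}
    (hS : E.IsARSequence S) :
    FinitelyManyUpToIso fun W : C => Indecomposable W ∧ stableLengthHom hfin W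
      (splitK0Class S.X₁ - splitK0Class S.X₂ + splitK0Class S.X₃) ≠ 0 := by
  obtain ⟨K, P, i, p, hip, hK, hP⟩ := hE.enough_projectives S.X₃
  refine ((finitelyManyUpToIso_retract hKS K).union
    (Set.finite_singleton (isoClass S.X₃))).subset ?_
  rintro _ ⟨W, ⟨hW, hne⟩, rfl⟩
  have hloc := isLocalRing_end_of_indecomposable hKS hW
  have hloc₃ := isLocalRing_end_of_indecomposable hKS hS.indecomposable_right
  by_contra hmem
  simp only [Set.mem_union, Set.mem_ofPred_eq, Set.mem_singleton_iff, not_or] at hmem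
  obtain ⟨hWK, hW₃⟩ := hmem
  obtain ⟨I, V, j, q, hjq, hV, hI⟩ := hE.enough_injectives W
  have hI' := (hE.projective_iff_injective I).2 hI
  apply hne
  have key := stableLength_eq_add hfin (W := W) S.f S.g
    (fun k hk => by
      rw [toStable_map_eq_zero_iff] at hk ⊢
      refine factorsThroughProjective_of_comp_f hE hS hV hI' (fun s r hsr => hWK ?_) k hk
      exact ⟨W, ⟨hW, retract_syzygy_of_retract_cosyzygy hE hK hV hP hI' hS.not_isProjective
        s r hsr⟩, rfl⟩)
    (by simp)
    (fun k hk => exact_toStable hS.conflation k ((toStable_map_eq_zero_iff _).1 hk))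
    (fun k => by
      obtain ⟨l, hl⟩ := hS.lift W k (fun ⟨⟨sp⟩⟩ => hW₃ (by
        obtain ⟨e⟩ := nonempty_iso_of_retract hS.indecomposable_right.1 sp.section_ k sp.id
        exact isoClass_eq_iff.2 ⟨e.symm⟩))
      exact ⟨l, by rw [hl]⟩)
  simp only [map_add, map_sub, stableLengthHom_splitK0Class]
  omega

lemma finitelyManyUpToIso_stableLengthHom_ne_zero (hE : E.IsFrobenius)
    (hKS : IsKrullSchmidt C) (hfin : IsHomFinite R E.StableCategory) {x : SplitK0 C}
    (hx : x ∈ E.arSubgroup) :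
    FinitelyManyUpToIso fun W : C => Indecomposable W ∧ stableLengthHom hfin W x ≠ 0 := by
  induction hx using AddSubgroup.closure_induction with
  | mem x hx =>
    obtain ⟨S, hS, rfl⟩ := hx
    exact hS.finitelyManyUpToIso_stableLengthHom_ne_zero hE hKS hfin
  | zero => simp [FinitelyManyUpToIso]
  | add x y _ _ hx hy =>
    refine (Set.Finite.union hx hy).subset ?_
    rintro _ ⟨W, ⟨hW, hne⟩, rfl⟩
    by_cases h : stableLengthHom hfin W x = 0
    · exact Or.inr ⟨W, ⟨hW, fun h' => hne (by simp [h, h'])⟩, rfl⟩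
    · exact Or.inl ⟨W, ⟨hW, h⟩, rfl⟩
  | neg x _ hx => simpa only [map_neg, ne_eq, neg_eq_zero] using hx

end Stable

end ExactStructure

open ExactStructure in
theorem mainTheorem2 {R : Type*} [CommRing R] {C : Type u} [Category.{v} C]
    [EssentiallySmall.{w} C] [Preadditive C] [Linear R C]
    [HasFiniteBiproducts C] [HasBinaryBiproducts C]
    (E : ExactStructure C) (hE : E.IsFrobenius) (hKS : IsKrullSchmidt C)
    (hfin : IsHomFinite R E.StableCategory)
    (hEx : E.exSubgroup = E.arSubgroup)
    (hX : ∃ X : C, ∀ Y : E.StableCategory, ¬ IsZero Y → ∃ f : Y ⟶ E.toStable.obj X, f ≠ 0) :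
    FinitelyManyUpToIso (fun U : C => Indecomposable U ∧ ¬ E.IsProjective U) ∧
    (FinitelyManyUpToIso (fun P : C => Indecomposable P ∧ E.IsProjective P) →
      FinitelyManyUpToIso (fun U : C => Indecomposable U)) := by
  have hfinite : FinitelyManyUpToIso (fun U : C => Indecomposable U ∧ ¬ E.IsProjective U) := by
    obtain ⟨X, hX⟩ := hX
    obtain ⟨K, P, i, p, hip, hK, hP⟩ := hE.enough_projectives X
    have hmem : splitK0Class K - splitK0Class P + splitK0Class X ∈ E.arSubgroup :=
      hEx ▸ AddSubgroup.subset_closure ⟨_, hK, rfl⟩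
    refine (finitelyManyUpToIso_stableLengthHom_ne_zero hE hKS hfin hmem).subset ?_
    rintro _ ⟨W, ⟨hW, hWP⟩, rfl⟩
    refine ⟨W, ⟨hW, ne_of_gt ?_⟩, rfl⟩
    obtain ⟨f, hf⟩ := hX (E.toStable.obj W) fun h => hWP (isProjective_iff_isZero_toStable.2 h)
    have h₁ : 0 < stableLength E R W X := stableLength_pos hfin f hf
    have h₂ : 0 ≤ stableLength E R W K := Int.natCast_nonneg _
    have h₃ := stableLength_of_isProjective R W hP
    simp only [map_add, map_sub, stableLengthHom_splitK0Class]
    omega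
  refine ⟨hfinite, fun hproj => (Set.Finite.union hfinite hproj).subset ?_⟩
  rintro _ ⟨W, hW, rfl⟩
  by_cases h : E.IsProjective W
  · exact Or.inr ⟨W, ⟨hW, h⟩, rfl⟩
  · exact Or.inl ⟨W, ⟨hW, h⟩, rfl⟩
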